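/- For a group $G$ with a free presentation $1\to R\to F\to G\to 1$ ($F$ free, $F'=[F,F]$) let $M(G)=(R\cap F')/[R,F]$ be its Schur multiplier, and let $G_{ab}=G/G'$. A homomorphism $f:G\to K$ induces $f_*:M(G)\to M(K)$, by lifting $f$ to the free groups of the presentations, and $f_*:G_{ab}\to K_{ab}$. Theorem 2.5. Let $G$ be the free product of groups $G_1$ and $G_2$ amalgamated over a common subgroup $H$, with injective maps $i_k:H\to G_k$ and canonical maps $j_k:G_k\to G$ ($k=1,2$). Then, for any choice of free presentations of the four groups, there is a Mayer–Vietoris exact sequence $$M(H)\xrightarrow{(i_{1*},\,i_{2*})} M(G_1)\oplus M(G_2)\xrightarrow{j_{1*}-j_{2*}} M(G)\xrightarrow{\ \delta\ } H_{ab}\xrightarrow{(i_{1*},\,i_{2*})} (G_1)_{ab}\oplus (G_2)_{ab}\xrightarrow{j_{1*}-j_{2*}} G_{ab}\to 0 ,$$ that is, the sequence is exact at $M(G_1)\oplus M(G_2)$, $M(G)$, $H_{ab}$, $(G_1)_{ab}\oplus (G_2)_{ab}$ and $G_{ab}$. Here $\delta$ is the Mayer–Vietoris connecting homomorphism (up to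 the usual choice of sign), described as follows: let $F/R$ be the free presentation of $G$, let $L$ be the kernel of $G_1*G_2\to G$, and let $\sigma:F\to G_1*G_2$ be any homomorphism compatible with the projections to $G$. Then for all $x\in R\cap F'$ and $h\in H$, $\delta(x[R,F])=hH'$ if and only if $\sigma(x)\equiv i_1(h)\,i_2(h)^{-1}\pmod{[L,\,G_1*G_2]}$. -/

import Mathlib

/-- A free presentation `1 → R → F → G → 1` of a group `G`: the free group `F` on a set of
generators together with a surjective homomorphism `π : F → G`. -/
structure FreePresentation.{u, v} (G : Type u) [Group G] where
  /-- the set of free generators -/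
  gens : Type v
  /-- the projection of the free group onto `G` -/
  π : FreeGroup gens →* G
  surjective : Function.Surjective π

namespace FreePresentation

section

open scoped commutatorElement

variable {G K : Type*} [Group G] [Group K]

/-- The free group `F` of the presentation. -/
abbrev F (P : FreePresentation G) : Type _ := FreeGroup P.gens

/-- The normal subgroup `R` of relations. -/
abbrev R (P : FreePresentation G) : Subgroup P.F := P.π.ker

/-- The subgroup `R ∩ F'` of `F`. -/
abbrev N (P : FreePresentation G) : Subgroup P.F := P.R ⊓ commutator P.F

/-- The subgroup `[R, F]`, viewed inside `R ∩ F'`. -/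
abbrev D (P : FreePresentation G) : Subgroup P.N :=
  (⁅P.R, (⊤ : Subgroup P.F)⁆).subgroupOf P.N

/-- The Schur multiplier `M(G) = (R ∩ F') / [R, F]`. -/
abbrev M (P : FreePresentation G) : Type _ := P.N ⧸ P.D

/-- The Schur multiplier is abelian. -/
instance (P : FreePresentation G) : CommGroup P.M where
  __ := (inferInstance : Group P.M)
  mul_comm := by
    intro a b
    induction a using QuotientGroup.induction_on with | H a => ?_
    induction b using QuotientGroup.induction_on with | H b => ?_
    rw [← QuotientGroup.mk_mul, ← QuotientGroup.mk_mul, QuotientGroup.eq,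
      Subgroup.mem_subgroupOf]
    have h := Subgroup.commutator_mem_commutator (H₁ := P.R) (H₂ := (⊤ : Subgroup P.F))
      (inv_mem b.2.1) (Subgroup.mem_top (a : P.F)⁻¹)
    simpa [commutatorElement_def, mul_assoc] using h

/-- A homomorphism `φ` of free groups is a lift of `f : G → K` if it is compatible with the
projections. -/
def IsLift (P : FreePresentation G) (Q : FreePresentation K) (f : G →* K)
    (φ : P.F →* Q.F) : Prop :=
  Q.π.comp φ = f.comp P.π

theorem IsLift.map_rel {P : FreePresentation G} {Q : FreePresentation K} {f : G →* K}
    {φ : P.F →* Q.F} (h : IsLift P Q f φ) {x : P.F} (hx : x ∈ P.R) : φ x ∈ Q.R := by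
  have h1 := DFunLike.congr_fun h x
  simp only [MonoidHom.comp_apply] at h1
  rw [MonoidHom.mem_ker] at hx ⊢
  rw [h1, hx, map_one]

theorem IsLift.map_commutator {P : FreePresentation G} {Q : FreePresentation K} {f : G →* K}
    {φ : P.F →* Q.F} (h : IsLift P Q f φ) {x : P.F} (hx : x ∈ ⁅P.R, (⊤ : Subgroup P.F)⁆) :
    φ x ∈ ⁅Q.R, (⊤ : Subgroup Q.F)⁆ := by
  have h1 : φ x ∈ (⁅P.R, (⊤ : Subgroup P.F)⁆).map φ := Subgroup.mem_map_of_mem _ hx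
  rw [Subgroup.map_commutator] at h1
  refine Subgroup.commutator_mono ?_ le_top h1
  rintro _ ⟨y, hy, rfl⟩
  exact h.map_rel hy

theorem IsLift.map_N {P : FreePresentation G} {Q : FreePresentation K} {f : G →* K}
    {φ : P.F →* Q.F} (h : IsLift P Q f φ) (x : P.N) : φ x ∈ Q.N := by
  refine ⟨h.map_rel x.2.1, ?_⟩
  have h1 : φ x ∈ (commutator P.F).map φ := Subgroup.mem_map_of_mem _ x.2.2
  rw [commutator_def, Subgroup.map_commutator] at h1
  exact Subgroup.commutator_mono le_top le_top h1

/-- The map of Schur multipliers induced by a lift: `x [R, F] ↦ φ(x) [S, E]`. -/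
def mapOfLift {P : FreePresentation G} {Q : FreePresentation K} {f : G →* K}
    (φ : P.F →* Q.F) (h : IsLift P Q f φ) : P.M →* Q.M :=
  QuotientGroup.map P.D Q.D
    ((φ.comp P.N.subtype).codRestrict Q.N h.map_N)
    (fun _ hx => h.map_commutator hx)

/-- Some lift of `f`, obtained by choosing preimages of the images of the generators. -/
noncomputable def someLift (P : FreePresentation G) (Q : FreePresentation K) (f : G →* K) :
    P.F →* Q.F :=
  FreeGroup.lift fun x => Function.surjInv Q.surjective (f (P.π (FreeGroup.of x)))

theorem isLift_someLift (P : FreePresentation G) (Q : FreePresentation K) (f : G →* K) :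
    IsLift P Q f (someLift P Q f) := by
  refine FreeGroup.ext_hom _ _ fun x => ?_
  simp [someLift, Function.surjInv_eq]

/-- The homomorphism `M(f) : M(G) → M(K)` induced by `f : G → K`; it does not depend on the
lift, see `map_eq_mapOfLift`. -/
noncomputable def map (P : FreePresentation G) (Q : FreePresentation K) (f : G →* K) :
    P.M →* Q.M :=
  mapOfLift (someLift P Q f) (isLift_someLift P Q f)

theorem map_eq_mapOfLift {P : FreePresentation G} {Q : FreePresentation K} {f : G →* K}
    (φ : P.F →* Q.F) (h : IsLift P Q f φ) : map P Q f = mapOfLift φ h := by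
  have key : ∀ x ∈ commutator P.F,
      QuotientGroup.mk' ⁅Q.R, (⊤ : Subgroup Q.F)⁆ (someLift P Q f x) =
        QuotientGroup.mk' ⁅Q.R, (⊤ : Subgroup Q.F)⁆ (φ x) := by
    intro x hx
    let q := QuotientGroup.mk' ⁅Q.R, (⊤ : Subgroup Q.F)⁆
    have hc : ∀ r ∈ Q.R, ∀ y, q r * q y = q y * q r := by
      intro r hr y
      rw [← map_mul, ← map_mul]
      refine (QuotientGroup.eq.2 ?_).symm
      have h1 := Subgroup.commutator_mem_commutator (H₁ := Q.R) (H₂ := (⊤ : Subgroup Q.F))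
        (inv_mem hr) (Subgroup.mem_top y⁻¹)
      simpa [commutatorElement_def, mul_assoc] using h1
    have hd : ∀ a : P.F, ∃ r ∈ Q.R, someLift P Q f a = r * φ a := by
      intro a
      refine ⟨someLift P Q f a * (φ a)⁻¹, ?_, by simp⟩
      have h1 := DFunLike.congr_fun h a
      have h2 := DFunLike.congr_fun (isLift_someLift P Q f) a
      simp only [MonoidHom.comp_apply] at h1 h2
      rw [MonoidHom.mem_ker, map_mul, map_inv, h1, h2, mul_inv_cancel]
    have hle : commutator P.F ≤
        (q.comp (someLift P Q f)).eqLocus (q.comp φ) := by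
      rw [commutator_def, Subgroup.commutator_le]
      intro a _ b _
      obtain ⟨r, hr, ha⟩ := hd a
      obtain ⟨s, hs, hb⟩ := hd b
      change q (someLift P Q f ⁅a, b⁆) = q (φ ⁅a, b⁆)
      rw [map_commutatorElement, map_commutatorElement, map_commutatorElement,
        map_commutatorElement, ha, hb]
      simp only [map_mul, commutatorElement_def, mul_inv_rev]
      have c1 : Commute (q r) (q (φ a)) := hc r hr (φ a)
      have c2 : Commute (q s) (q (φ b)) := hc s hs (φ b)
      have c3 : Commute (q r) (q (φ b)) := hc r hr (φ b)
      have c4 : Commute (q s) (q (φ a)) := hc s hs (φ a)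
      have c5 : Commute (q r) (q s) := hc r hr s
      calc q r * q (φ a) * (q s * q (φ b)) * ((q (φ a))⁻¹ * (q r)⁻¹) *
            ((q (φ b))⁻¹ * (q s)⁻¹)
          = q r * (q (φ a) * q s) * q (φ b) * (q (φ a))⁻¹ * ((q r)⁻¹ * (q (φ b))⁻¹) *
            (q s)⁻¹ := by group
        _ = q r * (q s * q (φ a)) * q (φ b) * (q (φ a))⁻¹ * ((q (φ b))⁻¹ * (q r)⁻¹) *
            (q s)⁻¹ := by rw [c4.eq, c3.inv_inv.eq]
        _ = (q r * q s) * ⁅q (φ a), q (φ b)⁆ * (q s * q r)⁻¹ := by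
            rw [commutatorElement_def]; group
        _ = ⁅q (φ a), q (φ b)⁆ := by
            have c6 : Commute (q r * q s) ⁅q (φ a), q (φ b)⁆ := by
              rw [commutatorElement_def]
              exact (((c1.mul_left c4).mul_right (c3.mul_left c2)).mul_right
                (c1.mul_left c4).inv_right).mul_right (c3.mul_left c2).inv_right
            rw [c6.eq, ← c5.eq, mul_assoc, mul_inv_cancel, mul_one]
    exact hle hx
  refine MonoidHom.ext fun x => ?_
  induction x using QuotientGroup.induction_on with | H x => ?_
  refine QuotientGroup.eq.2 ?_
  have h1 := QuotientGroup.eq.1 (key x x.2.2)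
  rw [Subgroup.mem_subgroupOf]
  exact h1

end

end FreePresentation

section

variable {H G₁ G₂ G : Type*} [Group H] [Group G₁] [Group G₂] [Group G]

/-- The element `i₁(h) i₂(h)⁻¹` of the free product `G₁ ∗ G₂`. -/
def amalgamRelator (i₁ : H →* G₁) (i₂ : H →* G₂) (h : H) : Monoid.Coprod G₁ G₂ :=
  Monoid.Coprod.inl (i₁ h) * (Monoid.Coprod.inr (i₂ h))⁻¹

/-- `G`, with the maps `j₁ : G₁ → G` and `j₂ : G₂ → G`, is the free product of `G₁` and `G₂`
amalgamated over their common subgroup `H` (embedded by `i₁` and `i₂`): it is the quotient of the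
free product `G₁ ∗ G₂` by the normal subgroup generated by the elements `i₁(h) i₂(h)⁻¹`. -/
structure IsAmalgamatedProduct (i₁ : H →* G₁) (i₂ : H →* G₂) (j₁ : G₁ →* G) (j₂ : G₂ →* G) :
    Prop where
  injective_left : Function.Injective i₁
  injective_right : Function.Injective i₂
  surjective : Function.Surjective (Monoid.Coprod.lift j₁ j₂)
  ker_eq : (Monoid.Coprod.lift j₁ j₂).ker =
    Subgroup.normalClosure (Set.range (amalgamRelator i₁ i₂))

/-- The description of the Mayer–Vietoris connecting homomorphism `δ : M(G) → H_ab`.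
Let `L` be the kernel of `G₁ ∗ G₂ → G`. Represent a class in `M(G)` by `x ∈ R ∩ F'` and let
`σ : F → G₁ ∗ G₂` be any homomorphism over `G`. Then `σ(x) ∈ L`, and `δ` sends the class of `x` to
the class of `h` exactly when `σ(x) ≡ i₁(h) i₂(h)⁻¹` modulo `[L, G₁ ∗ G₂]`. -/
def IsConnectingHom (i₁ : H →* G₁) (i₂ : H →* G₂) (j₁ : G₁ →* G) (j₂ : G₂ →* G)
    (P : FreePresentation G) (δ : P.M →* Abelianization H) : Prop :=
  ∀ σ : P.F →* Monoid.Coprod G₁ G₂, (Monoid.Coprod.lift j₁ j₂).comp σ = P.π →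
    ∀ (x : P.N) (h : H),
      δ (QuotientGroup.mk x) = Abelianization.of h ↔
        (amalgamRelator i₁ i₂ h)⁻¹ * σ x ∈
          ⁅(Monoid.Coprod.lift j₁ j₂).ker, (⊤ : Subgroup (Monoid.Coprod G₁ G₂))⁆

end

/-! ### Commutators modulo `[N, Y]` -/

section CentralQuotient

open scoped commutatorElement

variable {X Y G K : Type*} [Group X] [Group Y] [Group G] [Group K]

/-! Write `L` for the kernel of `G₁ ∗ G₂ → G`. The classes of the relators `i₁(h) i₂(h)⁻¹` are
central modulo `[L, G₁ ∗ G₂]`, so they depend multiplicatively on `h` and generate `L / [L, G₁ ∗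
G₂]`. The key fact is that this gives an isomorphism `H_ab ≅ L / [L, G₁ ∗ G₂]`. Under it `δ` is `x ↦
σ(x)`, and the sequence becomes the five-term sequence of `G₁ ∗ G₂ → G`, prolonged one step to the
left by `M(H)`.

Two principles do the work. First, modulo `[ker p, Y]` the kernel of `p : Y → G` is central, so the
class of a commutator depends only on its factors over `G`. Hence homomorphisms over `G` agree on
commutators (`mk'_eq_of_mem_commutator`), and commutators lift (`exists_mem_commutator_mk'_eq`).
This allows any group over `G` to be exchanged for a more convenient one.

Second, injectivity (of `H_ab → L / [L, G₁ ∗ G₂]`, and exactness at `M(G₁) × M(G₂)`) needs a target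
group in which an element outside `[S, Q₁ ∗ Q₂]` is visibly nontrivial, where `S` is the kernel of
`Q₁ ∗ Q₂ → G`. Such a target is an amalgam of two copies of a group `W` with a central subgroup `C`:
`W` embeds in it, while `S` is sent into the copy of `C`, which commutes with the whole image
(`IsAmalgamatedProduct.exists_lift_eq_one`). Injectivity of `i₁` and `i₂` is what makes the two
copies amalgamable. -/

theorem Subgroup.mk'_mem_center_of_mem (N : Subgroup Y) [N.Normal] {r : Y} (hr : r ∈ N) :
    QuotientGroup.mk' ⁅N, (⊤ : Subgroup Y)⁆ r ∈
      Subgroup.center (Y ⧸ ⁅N, (⊤ : Subgroup Y)⁆) := by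
  rw [Subgroup.mem_center_iff]
  intro g
  obtain ⟨y, rfl⟩ := QuotientGroup.mk'_surjective _ g
  rw [← map_mul, ← map_mul]
  refine QuotientGroup.eq.2 ?_
  have h := Subgroup.commutator_mem_commutator (H₁ := N) (H₂ := (⊤ : Subgroup Y))
    (inv_mem hr) (Subgroup.mem_top y⁻¹)
  simpa [commutatorElement_def, mul_assoc] using h

theorem commutatorElement_eq_of_mem_center {c d u v : X} (hc : c ∈ Subgroup.center X)
    (hd : d ∈ Subgroup.center X) : ⁅c * u, d * v⁆ = ⁅u, v⁆ := by
  rw [Subgroup.mem_center_iff] at hc hd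
  simp only [commutatorElement_def, mul_inv_rev]
  calc c * u * (d * v) * (u⁻¹ * c⁻¹) * (v⁻¹ * d⁻¹)
      = c * (u * d) * v * u⁻¹ * c⁻¹ * v⁻¹ * d⁻¹ := by group
    _ = (c * d) * (u * v * u⁻¹) * c⁻¹ * v⁻¹ * d⁻¹ := by rw [hd u]; group
    _ = (u * v * u⁻¹) * (c * d) * c⁻¹ * v⁻¹ * d⁻¹ := by
        rw [← mul_assoc (u * v * u⁻¹), hc (u * v * u⁻¹), mul_assoc c _ d, hd (u * v * u⁻¹)]
        group
    _ = u * v * u⁻¹ * v⁻¹ := by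
        rw [hd c, show u * v * u⁻¹ * (d * c) * c⁻¹ * v⁻¹ * d⁻¹
          = u * v * u⁻¹ * (d * v⁻¹) * d⁻¹ by group, ← hd v⁻¹]
        group

/-- Two homomorphisms which agree over `G` agree on commutators modulo `[ker p, Y]`. -/
theorem mk'_eq_of_mem_commutator (p : Y →* G) {a b : X →* Y} (h : p.comp a = p.comp b)
    {x : X} (hx : x ∈ commutator X) :
    QuotientGroup.mk' ⁅p.ker, (⊤ : Subgroup Y)⁆ (a x) =
      QuotientGroup.mk' ⁅p.ker, (⊤ : Subgroup Y)⁆ (b x) := by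
  set q := QuotientGroup.mk' ⁅p.ker, (⊤ : Subgroup Y)⁆ with hq
  have hd : ∀ y, ∃ c ∈ Subgroup.center (Y ⧸ ⁅p.ker, (⊤ : Subgroup Y)⁆),
      q (a y) = c * q (b y) := fun y => by
    refine ⟨q (a y * (b y)⁻¹), Subgroup.mk'_mem_center_of_mem _ ?_, by simp⟩
    have := DFunLike.congr_fun h y
    simp only [MonoidHom.comp_apply] at this
    rw [MonoidHom.mem_ker, map_mul, map_inv, this, mul_inv_cancel]
  have hle : commutator X ≤ (q.comp a).eqLocus (q.comp b) := by
    rw [commutator_def, Subgroup.commutator_le]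
    intro u _ v _
    change q (a ⁅u, v⁆) = q (b ⁅u, v⁆)
    obtain ⟨c, hc, hu⟩ := hd u
    obtain ⟨d, hd, hv⟩ := hd v
    simp only [map_commutatorElement]
    rw [hu, hv, commutatorElement_eq_of_mem_center hc hd]
  exact hle hx

theorem map_mem_commutator_ker {pX : X →* G} {p : Y →* K} {f : G →* K} {t : X →* Y}
    (h : p.comp t = f.comp pX) {x : X} (hx : x ∈ ⁅pX.ker, (⊤ : Subgroup X)⁆) :
    t x ∈ ⁅p.ker, (⊤ : Subgroup Y)⁆ := by
  have h1 := Subgroup.mem_map_of_mem t hx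
  rw [Subgroup.map_commutator] at h1
  refine Subgroup.commutator_mono ?_ le_top h1
  rintro _ ⟨y, hy, rfl⟩
  have := DFunLike.congr_fun h y
  simp only [MonoidHom.comp_apply] at this
  rw [SetLike.mem_coe, MonoidHom.mem_ker] at hy
  rw [MonoidHom.mem_ker, this, hy, map_one]

theorem mk'_map_eq_mk'_map {pX : X →* G} {p : Y →* K} {f : G →* K} {t : X →* Y}
    (h : p.comp t = f.comp pX) {x y : X}
    (hx : QuotientGroup.mk' ⁅pX.ker, (⊤ : Subgroup X)⁆ x = QuotientGroup.mk' _ y) :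
    QuotientGroup.mk' ⁅p.ker, (⊤ : Subgroup Y)⁆ (t x) = QuotientGroup.mk' _ (t y) := by
  refine QuotientGroup.eq.2 ?_
  rw [← map_inv, ← map_mul]
  exact map_mem_commutator_ker h (QuotientGroup.eq.1 hx)

theorem map_mem_commutator (t : X →* Y) {x : X} (hx : x ∈ commutator X) :
    t x ∈ commutator Y := by
  have h1 := Subgroup.mem_map_of_mem t hx
  rw [commutator_def, Subgroup.map_commutator] at h1
  exact Subgroup.commutator_mono le_top le_top h1

/-- Commutators lift modulo `[ker p, Y]` along a homomorphism over `G`. -/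
theorem exists_mem_commutator_mk'_eq {pX : X →* G} (hpX : Function.Surjective pX) (p : Y →* G)
    {s : X →* Y} (h : p.comp s = pX) {y : Y} (hy : y ∈ commutator Y) :
    ∃ x ∈ commutator X, QuotientGroup.mk' ⁅p.ker, (⊤ : Subgroup Y)⁆ (s x) =
      QuotientGroup.mk' ⁅p.ker, (⊤ : Subgroup Y)⁆ y := by
  set q := QuotientGroup.mk' ⁅p.ker, (⊤ : Subgroup Y)⁆ with hq
  have hd : ∀ y, ∃ x, ∃ c ∈ Subgroup.center (Y ⧸ ⁅p.ker, (⊤ : Subgroup Y)⁆),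
      q y = c * q (s x) := fun y => by
    obtain ⟨x, hx⟩ := hpX (p y)
    refine ⟨x, q (y * (s x)⁻¹), Subgroup.mk'_mem_center_of_mem _ ?_, by simp⟩
    have := DFunLike.congr_fun h x
    simp only [MonoidHom.comp_apply] at this
    rw [MonoidHom.mem_ker, map_mul, map_inv, this, hx, mul_inv_cancel]
  have hle : commutator Y ≤ ((commutator X).map (q.comp s)).comap q := by
    rw [commutator_def, Subgroup.commutator_le]
    intro u _ v _
    obtain ⟨x, c, hc, hu⟩ := hd u
    obtain ⟨z, d, hd, hv⟩ := hd v
    refine ⟨⁅x, z⁆, Subgroup.commutator_mem_commutator (Subgroup.mem_top _)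
      (Subgroup.mem_top _), ?_⟩
    simp only [map_commutatorElement]
    rw [hu, hv, commutatorElement_eq_of_mem_center hc hd]
    rfl
  exact hle hy

/-- For `n ∈ T ≤ N`, the conjugate `g n g⁻¹` is `[n, g]⁻¹ n`. -/
theorem Subgroup.normal_of_commutator_le {N T : Subgroup Y} (h : ⁅N, (⊤ : Subgroup Y)⁆ ≤ T)
    (hT : T ≤ N) : T.Normal where
  conj_mem n hn g := by
    have h1 := mul_mem (inv_mem (h (Subgroup.commutator_mem_commutator (hT hn)
      (Subgroup.mem_top g)))) hn
    simpa [commutatorElement_def, mul_assoc] using h1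

theorem FreeGroup.exists_comp_eq {α : Type*} {p : Y →* G} (hp : Function.Surjective p)
    (π : FreeGroup α →* G) : ∃ s : FreeGroup α →* Y, p.comp s = π :=
  ⟨FreeGroup.lift fun x => Function.surjInv hp (π (FreeGroup.of x)),
    FreeGroup.ext_hom _ _ fun x => by simp [Function.surjInv_eq]⟩

theorem mem_commutator_of_of_eq_one {h : X} (hh : Abelianization.of h = 1) : h ∈ commutator X := by
  rwa [← Abelianization.ker_of, MonoidHom.mem_ker]

end CentralQuotient

/-! ### Gluing two copies of a group along a central subgroup -/

section Amalgam

universe u v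

/-- Two homomorphisms from `K` to `W` with the same kernel become equal after embedding the two
copies of `W` in a larger group. -/
theorem exists_amalgam {K : Type u} {W : Type v} [Group K] [Group W] (a₁ a₂ : K →* W)
    (h : a₁.ker = a₂.ker) : ∃ (E : Type (max u v)) (_ : Group E) (b₁ b₂ : W →* E),
      Function.Injective b₁ ∧ b₁.comp a₁ = b₂.comp a₂ := by
  let φ : Bool → K ⧸ a₁.ker →* W := fun i =>
    bif i then QuotientGroup.kerLift a₁ else QuotientGroup.lift a₁.ker a₂ (fun x hx => by
      rw [h] at hx; exact hx)
  have hφ : ∀ i, Function.Injective (φ i) := by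
    rintro (_ | _)
    · rw [← MonoidHom.ker_eq_bot_iff, eq_bot_iff]
      intro x hx
      induction x using QuotientGroup.induction_on with | H x => ?_
      refine Subgroup.mem_bot.2 ((QuotientGroup.eq_one_iff x).2 ?_)
      rw [h]
      exact hx
    · exact QuotientGroup.kerLift_injective a₁
  refine ⟨Monoid.PushoutI φ, inferInstance, Monoid.PushoutI.of (φ := φ) true,
    Monoid.PushoutI.of (φ := φ) false, Monoid.PushoutI.of_injective hφ true, ?_⟩
  ext k
  have h1 := Monoid.PushoutI.of_apply_eq_base φ true (QuotientGroup.mk k)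
  have h2 := Monoid.PushoutI.of_apply_eq_base φ false (QuotientGroup.mk k)
  exact h1.trans h2.symm

/-- Centrality of `C` makes `(k, c) ↦ aᵢ(k) c` a homomorphism on `K × C`. The two hypotheses say
exactly that these two homomorphisms have the same kernel, so `C` can be glued identically along
with `K`. -/
theorem exists_amalgam_of_central {K : Type u} {W : Type v} [Group K] [Group W]
    {C : Subgroup W} (hC : C ≤ Subgroup.center W) (a₁ a₂ : K →* W)
    (h₁ : ∀ k, a₁ k ∈ C → a₁ k = a₂ k) (h₂ : ∀ k, a₂ k ∈ C → a₁ k = a₂ k) :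
    ∃ (E : Type (max u v)) (_ : Group E) (b₁ b₂ : W →* E),
      Function.Injective b₁ ∧ (∀ k, b₁ (a₁ k) = b₂ (a₂ k)) ∧ ∀ c ∈ C, b₁ c = b₂ c := by
  have hc : ∀ (a : K →* W) k (c : C), Commute (a k) (C.subtype c) := fun a k c =>
    (Subgroup.mem_center_iff.1 (hC c.2) (a k))
  obtain ⟨E, hE, b₁, b₂, hb, hab⟩ := exists_amalgam
    (MonoidHom.noncommCoprod a₁ C.subtype (hc a₁)) (MonoidHom.noncommCoprod a₂ C.subtype (hc a₂))
    (by
      ext ⟨k, c⟩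
      simp only [MonoidHom.mem_ker, MonoidHom.noncommCoprod_apply, mul_eq_one_iff_eq_inv]
      constructor
      · intro h
        rw [← h₁ k (by rw [h]; exact inv_mem c.2), h]
      · intro h
        rw [h₂ k (by rw [h]; exact inv_mem c.2), h])
  refine ⟨E, hE, b₁, b₂, hb, fun k => ?_, fun c hc => ?_⟩
  · simpa using DFunLike.congr_fun hab (k, 1)
  · simpa using DFunLike.congr_fun hab (1, ⟨c, hc⟩)

end Amalgam

/-! ### Kernels of maps out of free products -/

section FreeProduct

universe u v

open Monoid
open scoped commutatorElement

variable {H G₁ G₂ G Q₁ Q₂ : Type*} {Q₀ : Type u} [Group H] [Group G₁] [Group G₂] [Group G]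
  [Group Q₀] [Group Q₁] [Group Q₂]

theorem IsAmalgamatedProduct.comp_eq {i₁ : H →* G₁} {i₂ : H →* G₂} {j₁ : G₁ →* G}
    {j₂ : G₂ →* G} (hG : IsAmalgamatedProduct i₁ i₂ j₁ j₂) : j₁.comp i₁ = j₂.comp i₂ := by
  ext h
  have h1 : amalgamRelator i₁ i₂ h ∈ (Coprod.lift j₁ j₂).ker := by
    rw [hG.ker_eq]
    exact Subgroup.subset_normalClosure ⟨h, rfl⟩
  simpa [amalgamRelator, MonoidHom.mem_ker, mul_inv_eq_one] using h1

/-- The quotient map by `T` kills both kernels, so it descends on each free factor. This shows that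
the kernel of `Q₁ ∗ Q₂ → G₁ ∗ G₂` is normally generated by the two kernels. -/
theorem exists_comp_coprod_map_eq_mk' {π₁ : Q₁ →* G₁} {π₂ : Q₂ →* G₂}
    (hπ₁ : Function.Surjective π₁) (hπ₂ : Function.Surjective π₂)
    (T : Subgroup (Coprod Q₁ Q₂)) [T.Normal]
    (h₁ : ∀ r ∈ π₁.ker, Coprod.inl r ∈ T) (h₂ : ∀ r ∈ π₂.ker, Coprod.inr r ∈ T) :
    ∃ κ : Coprod G₁ G₂ →* Coprod Q₁ Q₂ ⧸ T,
      κ.comp (Coprod.map π₁ π₂) = QuotientGroup.mk' T := by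
  let κ₁ := π₁.liftOfSurjective hπ₁ ⟨(QuotientGroup.mk' T).comp Coprod.inl, fun r hr =>
    (QuotientGroup.eq_one_iff _).2 (h₁ r hr)⟩
  let κ₂ := π₂.liftOfSurjective hπ₂ ⟨(QuotientGroup.mk' T).comp Coprod.inr, fun r hr =>
    (QuotientGroup.eq_one_iff _).2 (h₂ r hr)⟩
  refine ⟨Coprod.lift κ₁ κ₂, Coprod.hom_ext ?_ ?_⟩
  · ext x
    simp only [MonoidHom.comp_apply, Coprod.map_apply_inl, Coprod.lift_apply_inl]
    exact MonoidHom.liftOfRightInverse_comp_apply _ _ _ _ x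
  · ext x
    simp only [MonoidHom.comp_apply, Coprod.map_apply_inr, Coprod.lift_apply_inr]
    exact MonoidHom.liftOfRightInverse_comp_apply _ _ _ _ x

theorem ker_coprod_map_le {π₁ : Q₁ →* G₁} {π₂ : Q₂ →* G₂}
    (hπ₁ : Function.Surjective π₁) (hπ₂ : Function.Surjective π₂)
    (T : Subgroup (Coprod Q₁ Q₂)) [T.Normal]
    (h₁ : ∀ r ∈ π₁.ker, Coprod.inl r ∈ T) (h₂ : ∀ r ∈ π₂.ker, Coprod.inr r ∈ T) :
    (Coprod.map π₁ π₂).ker ≤ T := by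
  obtain ⟨κ, hκ⟩ := exists_comp_coprod_map_eq_mk' hπ₁ hπ₂ T h₁ h₂
  intro z hz
  rw [← QuotientGroup.ker_mk' T, ← hκ, MonoidHom.mem_ker, MonoidHom.comp_apply,
    MonoidHom.mem_ker.1 hz, map_one]

theorem lift_comp_coprod_map (π₁ : Q₁ →* G₁) (π₂ : Q₂ →* G₂) (j₁ : G₁ →* G) (j₂ : G₂ →* G) :
    (Coprod.lift j₁ j₂).comp (Coprod.map π₁ π₂) =
      Coprod.lift (j₁.comp π₁) (j₂.comp π₂) :=
  Coprod.hom_ext (by ext; simp) (by ext; simp)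

variable {i₁ : H →* G₁} {i₂ : H →* G₂} {j₁ : G₁ →* G} {j₂ : G₂ →* G}

/-- The relations of an amalgamated product with respect to `Q₁ ∗ Q₂`, where `Qₖ` maps onto
`Gₖ`. -/
theorem IsAmalgamatedProduct.ker_lift_le (hG : IsAmalgamatedProduct i₁ i₂ j₁ j₂)
    {π₀ : Q₀ →* H} {π₁ : Q₁ →* G₁} {π₂ : Q₂ →* G₂}
    (hπ₀ : Function.Surjective π₀) (hπ₁ : Function.Surjective π₁)
    (hπ₂ : Function.Surjective π₂) {ψ₁ : Q₀ →* Q₁} {ψ₂ : Q₀ →* Q₂}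
    (hψ₁ : π₁.comp ψ₁ = i₁.comp π₀) (hψ₂ : π₂.comp ψ₂ = i₂.comp π₀)
    (T : Subgroup (Coprod Q₁ Q₂)) [T.Normal]
    (h₁ : ∀ r ∈ π₁.ker, Coprod.inl r ∈ T) (h₂ : ∀ r ∈ π₂.ker, Coprod.inr r ∈ T)
    (h₀ : ∀ x, amalgamRelator ψ₁ ψ₂ x ∈ T) :
    (Coprod.lift (j₁.comp π₁) (j₂.comp π₂)).ker ≤ T := by
  obtain ⟨κ, hκ⟩ := exists_comp_coprod_map_eq_mk' hπ₁ hπ₂ T h₁ h₂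
  have hL : (Coprod.lift j₁ j₂).ker ≤ κ.ker := by
    rw [hG.ker_eq]
    refine Subgroup.normalClosure_le_normal ?_
    rintro _ ⟨h, rfl⟩
    obtain ⟨x, rfl⟩ := hπ₀ h
    have e : amalgamRelator i₁ i₂ (π₀ x) = Coprod.map π₁ π₂ (amalgamRelator ψ₁ ψ₂ x) := by
      have e1 := DFunLike.congr_fun hψ₁ x
      have e2 := DFunLike.congr_fun hψ₂ x
      simp only [MonoidHom.comp_apply] at e1 e2
      simp [amalgamRelator, e1, e2]
    rw [SetLike.mem_coe, MonoidHom.mem_ker, e, ← MonoidHom.comp_apply, hκ]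
    exact (QuotientGroup.eq_one_iff _).2 (h₀ x)
  intro z hz
  rw [← lift_comp_coprod_map] at hz
  rw [← QuotientGroup.ker_mk' T, ← hκ]
  exact hL hz

/-- Compatible central data on `Q₁` and `Q₂` give a homomorphism from `Q₁ ∗ Q₂` to a group
containing the group of coefficients, and it is trivial on `[S, Q₁ ∗ Q₂]`, where `S` is the kernel
of the projection to the amalgamated product. -/
theorem IsAmalgamatedProduct.exists_lift_eq_one (hG : IsAmalgamatedProduct i₁ i₂ j₁ j₂)
    {π₀ : Q₀ →* H} {π₁ : Q₁ →* G₁} {π₂ : Q₂ →* G₂}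
    (hπ₀ : Function.Surjective π₀) (hπ₁ : Function.Surjective π₁)
    (hπ₂ : Function.Surjective π₂) {ψ₁ : Q₀ →* Q₁} {ψ₂ : Q₀ →* Q₂}
    (hψ₁ : π₁.comp ψ₁ = i₁.comp π₀) (hψ₂ : π₂.comp ψ₂ = i₂.comp π₀)
    {W : Type v} [Group W] {C : Subgroup W} (hC : C ≤ Subgroup.center W)
    (g₁ : Q₁ →* W) (g₂ : Q₂ →* W) (a₁ a₂ : Q₀ →* W)
    (hg₁ : ∀ r ∈ π₁.ker, g₁ r ∈ C) (hg₂ : ∀ r ∈ π₂.ker, g₂ r ∈ C)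
    (ha₁ : ∀ x, (a₁ x)⁻¹ * g₁ (ψ₁ x) ∈ C) (ha₂ : ∀ x, (a₂ x)⁻¹ * g₂ (ψ₂ x) ∈ C)
    (h₁ : ∀ x, a₁ x ∈ C → a₁ x = a₂ x) (h₂ : ∀ x, a₂ x ∈ C → a₁ x = a₂ x) :
    ∃ (E : Type (max u v)) (_ : Group E) (b₁ b₂ : W →* E),
      Function.Injective b₁ ∧ (∀ x, b₁ (a₁ x) = b₂ (a₂ x)) ∧ (∀ c ∈ C, b₁ c = b₂ c) ∧
      ∀ z ∈ ⁅(Coprod.lift (j₁.comp π₁) (j₂.comp π₂)).ker, (⊤ : Subgroup (Coprod Q₁ Q₂))⁆,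
        Coprod.lift (b₁.comp g₁) (b₂.comp g₂) z = 1 := by
  obtain ⟨E, hE, b₁, b₂, hb, hab, hbC⟩ := exists_amalgam_of_central hC a₁ a₂ h₁ h₂
  refine ⟨E, hE, b₁, b₂, hb, hab, hbC, ?_⟩
  set B := Coprod.lift (b₁.comp g₁) (b₂.comp g₂) with hB
  have hcomm : ∀ c ∈ C, ∀ z, Commute (b₁ c) (B z) := by
    intro c hc z
    have hw := Subgroup.mem_center_iff.1 (hC hc)
    induction z using Coprod.induction_on with
    | inl x => simpa [hB] using ((show Commute c (g₁ x) from (hw _).symm).map b₁)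
    | inr x =>
      rw [hbC c hc]
      simpa [hB] using ((show Commute c (g₂ x) from (hw _).symm).map b₂)
    | mul x y hx hy => rw [map_mul]; exact hx.mul_right hy
  -- It suffices to send the kernel `S` into `b₁(C)`, which centralises the image of `B`. For the
  -- same reason `T` is normal, so only normal generators of `S` need checking.
  let T : Subgroup (Coprod Q₁ Q₂) := (C.map b₁).comap B
  have hT : T.Normal := ⟨by
    rintro z ⟨c, hc, hz⟩ y
    refine ⟨c, hc, ?_⟩
    rw [map_mul, map_mul, ← hz, map_inv, ← (hcomm c hc y).eq, mul_inv_cancel_right]⟩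
  have hS : (Coprod.lift (j₁.comp π₁) (j₂.comp π₂)).ker ≤ T := by
    refine hG.ker_lift_le hπ₀ hπ₁ hπ₂ hψ₁ hψ₂ T (fun r hr => ⟨_, hg₁ r hr, by simp [hB]⟩)
      (fun r hr => ⟨_, hg₂ r hr, by rw [hbC _ (hg₂ r hr)]; simp [hB]⟩) fun x => ?_
    set c₁ := (a₁ x)⁻¹ * g₁ (ψ₁ x) with hc₁
    set c₂ := (a₂ x)⁻¹ * g₂ (ψ₂ x) with hc₂
    have hc : c₁ * c₂⁻¹ ∈ C := mul_mem (ha₁ x) (inv_mem (ha₂ x))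
    refine ⟨c₁ * c₂⁻¹, hc, ?_⟩
    have e₁ : g₁ (ψ₁ x) = a₁ x * c₁ := by rw [hc₁, mul_inv_cancel_left]
    have e₂ : g₂ (ψ₂ x) = a₂ x * c₂ := by rw [hc₂, mul_inv_cancel_left]
    -- After gluing, `B` sends the relator of `x` to `b₂` of the right-hand side; the conjugation by
    -- `a₂ x` disappears because `c₁ c₂⁻¹` is central.
    have e₃ : c₁ * c₂⁻¹ = a₂ x * c₁ * (a₂ x * c₂)⁻¹ := by
      rw [show a₂ x * c₁ * (a₂ x * c₂)⁻¹ = a₂ x * (c₁ * c₂⁻¹) * (a₂ x)⁻¹ by group,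
        Subgroup.mem_center_iff.1 (hC hc), mul_inv_cancel_right]
    have e₄ : b₁ c₁ = b₂ c₁ := hbC _ (ha₁ x)
    rw [hbC _ hc, e₃]
    simp [hB, amalgamRelator, e₁, e₂, hab, e₄]
  intro z hz
  have : ⁅(Coprod.lift (j₁.comp π₁) (j₂.comp π₂)).ker, (⊤ : Subgroup (Coprod Q₁ Q₂))⁆ ≤
      B.ker := by
    rw [Subgroup.commutator_le]
    intro s hs y _
    obtain ⟨c, hc, hz⟩ := hS hs
    rw [MonoidHom.mem_ker, map_commutatorElement, commutatorElement_eq_one_iff_commute, ← hz]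
    exact hcomm c hc y
  exact this hz

end FreeProduct

/-! ### Two injectivity statements obtained from amalgams -/

section Detection

open Monoid
open scoped commutatorElement

variable {H G₁ G₂ G Q₀ Q₁ Q₂ : Type*} [Group H] [Group G₁] [Group G₂] [Group G]
  [Group Q₀] [Group Q₁] [Group Q₂]
  {i₁ : H →* G₁} {i₂ : H →* G₂} {j₁ : G₁ →* G} {j₂ : G₂ →* G}

/-- The homomorphism `H_ab → L / [L, G₁ ∗ G₂]` is injective. -/
theorem IsAmalgamatedProduct.of_eq_one_of_relator_mem (hG : IsAmalgamatedProduct i₁ i₂ j₁ j₂)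
    {h : H} (hh : amalgamRelator i₁ i₂ h ∈
      ⁅(Coprod.lift j₁ j₂).ker, (⊤ : Subgroup (Coprod G₁ G₂))⁆) :
    Abelianization.of h = 1 := by
  -- In `W = G₁ × G₂ × H_ab`, the element `(i₁(h), 1, 1)` of the first copy is glued to `(1, i₂(h),
  -- [h])` of the second. The extra coordinate records `[h]`: the relator of `h` is sent to `(1, 1,
  -- [h])`.
  let C : Subgroup (G₁ × G₂ × Abelianization H) :=
    (⊥ : Subgroup G₁).prod ((⊥ : Subgroup G₂).prod ⊤)
  have hmem : ∀ w : G₁ × G₂ × Abelianization H, w ∈ C ↔ w.1 = 1 ∧ w.2.1 = 1 := fun w => by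
    simp [C, Subgroup.mem_prod]
  obtain ⟨E, hE, b₁, b₂, hb, hab, hbC, hB⟩ := hG.exists_lift_eq_one (π₀ := MonoidHom.id H)
    (π₁ := MonoidHom.id G₁) (π₂ := MonoidHom.id G₂) Function.surjective_id
    Function.surjective_id Function.surjective_id (ψ₁ := i₁) (ψ₂ := i₂) rfl rfl (C := C)
    (fun w hw => by
      obtain ⟨h1, h2⟩ := (hmem w).1 hw
      refine Subgroup.mem_center_iff.2 fun g => ?_
      refine Prod.ext ?_ (Prod.ext ?_ ?_)
      · simp [h1]
      · simp [h2]
      · exact mul_comm _ _)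
    (MonoidHom.inl G₁ (G₂ × Abelianization H))
    ((MonoidHom.inr G₁ (G₂ × Abelianization H)).comp (MonoidHom.inl G₂ (Abelianization H)))
    ((MonoidHom.inl G₁ (G₂ × Abelianization H)).comp i₁)
    ((MonoidHom.inr G₁ (G₂ × Abelianization H)).comp (i₂.prod Abelianization.of))
    (fun r hr => by
      have : r = 1 := hr
      rw [this, map_one]; exact one_mem _)
    (fun r hr => by
      have : r = 1 := hr
      rw [this, map_one]; exact one_mem _)
    (fun x => by simp [hmem]) (fun x => by simp [hmem])
    (fun x hx => by
      have : x = 1 := by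
        refine hG.injective_left ?_
        rw [map_one]
        exact ((hmem _).1 hx).1
      rw [this, map_one, map_one])
    (fun x hx => by
      have : x = 1 := by
        refine hG.injective_right ?_
        rw [map_one]
        exact ((hmem _).1 hx).2
      rw [this, map_one, map_one])
  have h1 := hB (amalgamRelator i₁ i₂ h) hh
  simp only [amalgamRelator, map_mul, map_inv, Coprod.lift_apply_inl, Coprod.lift_apply_inr,
    MonoidHom.comp_apply, mul_inv_eq_one] at h1
  have h2 := hab h
  simp only [MonoidHom.comp_apply] at h2
  rw [h1, ← mul_inv_eq_one, ← map_inv, ← map_mul, ← hbC] at h2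
  · have h3 := hb (h2.trans (map_one b₁).symm)
    simpa using congrArg (fun w => w.2.2) h3
  · simp [hmem]

/-- If relations `w₁` and `w₂` of `G₁` and `G₂` agree modulo `[S, Q₁ ∗ Q₂]`, where `S` is the
kernel of the projection to the amalgamated product, then they come from a relation of `H`. -/
theorem IsAmalgamatedProduct.exists_mem_ker_of_mul_inv_mem
    (hG : IsAmalgamatedProduct i₁ i₂ j₁ j₂)
    {π₀ : Q₀ →* H} {π₁ : Q₁ →* G₁} {π₂ : Q₂ →* G₂}
    (hπ₀ : Function.Surjective π₀) (hπ₁ : Function.Surjective π₁)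
    (hπ₂ : Function.Surjective π₂) {ψ₁ : Q₀ →* Q₁} {ψ₂ : Q₀ →* Q₂}
    (hψ₁ : π₁.comp ψ₁ = i₁.comp π₀) (hψ₂ : π₂.comp ψ₂ = i₂.comp π₀)
    {w₁ : Q₁} {w₂ : Q₂} (hw₂ : w₂ ∈ π₂.ker)
    (hw : Coprod.inl w₁ * (Coprod.inr w₂)⁻¹ ∈
      ⁅(Coprod.lift (j₁.comp π₁) (j₂.comp π₂)).ker, (⊤ : Subgroup (Coprod Q₁ Q₂))⁆) :
    ∃ r ∈ π₀.ker,
      QuotientGroup.mk' ⁅π₁.ker, (⊤ : Subgroup Q₁)⁆ w₁ = QuotientGroup.mk' _ (ψ₁ r) ∧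
      QuotientGroup.mk' ⁅π₂.ker, (⊤ : Subgroup Q₂)⁆ w₂ = QuotientGroup.mk' _ (ψ₂ r) := by
  set q₁ := QuotientGroup.mk' ⁅π₁.ker, (⊤ : Subgroup Q₁)⁆ with hq₁
  set q₂ := QuotientGroup.mk' ⁅π₂.ker, (⊤ : Subgroup Q₂)⁆ with hq₂
  have hR₁ : ∀ r ∈ π₀.ker, ψ₁ r ∈ π₁.ker := fun r hr => by
    rw [MonoidHom.mem_ker, ← MonoidHom.comp_apply, hψ₁, MonoidHom.comp_apply,
      MonoidHom.mem_ker.1 hr, map_one]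
  have hR₂ : ∀ r ∈ π₀.ker, ψ₂ r ∈ π₂.ker := fun r hr => by
    rw [MonoidHom.mem_ker, ← MonoidHom.comp_apply, hψ₂, MonoidHom.comp_apply,
      MonoidHom.mem_ker.1 hr, map_one]
  have hc₂ : ∀ r ∈ π₂.ker, ∀ y, y * q₂ r = q₂ r * y := fun r hr =>
    Subgroup.mem_center_iff.1 (Subgroup.mk'_mem_center_of_mem _ hr)
  have hle₁ : ⁅π₁.ker, (⊤ : Subgroup Q₁)⁆ ≤ π₁.ker := Subgroup.commutator_le_left _ _
  have hle₂ : ⁅π₂.ker, (⊤ : Subgroup Q₂)⁆ ≤ π₂.ker := Subgroup.commutator_le_left _ _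
  let Φ := MonoidHom.prodMap π₁ π₂
  -- Dividing `Q₁ × Q₂` by `J` kills `[ker πₖ, Qₖ]` in each factor and identifies `ψ₁(r)` with
  -- `ψ₂(r)` only for the relations `r` of `H`. Thus `w₁ = w₂` in the quotient is exactly the
  -- desired conclusion.
  let J : Subgroup (Q₁ × Q₂) :=
    { carrier := {w | ∃ r ∈ π₀.ker, q₁ w.1 = q₁ (ψ₁ r) ∧ q₂ w.2 = (q₂ (ψ₂ r))⁻¹}
      one_mem' := ⟨1, one_mem _, by simp, by simp⟩
      mul_mem' := by
        rintro w w' ⟨r, hr, h1, h2⟩ ⟨r', hr', h1', h2'⟩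
        refine ⟨r * r', mul_mem hr hr', by simp [h1, h1'], ?_⟩
        rw [Prod.snd_mul, map_mul, h2, h2', map_mul, map_mul, ← mul_inv_rev,
          hc₂ _ (hR₂ _ hr)]
      inv_mem' := by
        rintro w ⟨r, hr, h1, h2⟩
        exact ⟨r⁻¹, inv_mem hr, by simp [h1], by simp [h2]⟩ }
  have hJle : J ≤ Φ.ker := by
    rintro w ⟨r, hr, h1, h2⟩
    have e1 := hle₁ (QuotientGroup.eq.1 h1.symm)
    rw [← map_inv] at h2
    have e2 := hle₂ (QuotientGroup.eq.1 h2.symm)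
    refine MonoidHom.mem_ker.2 (Prod.ext ?_ ?_)
    · exact ((Subgroup.mul_mem_cancel_left _ (inv_mem (hR₁ r hr))).1 e1)
    · rw [inv_inv] at e2
      exact ((Subgroup.mul_mem_cancel_left _ (hR₂ r hr)).1 e2)
  have hleJ : ⁅Φ.ker, (⊤ : Subgroup (Q₁ × Q₂))⁆ ≤ J := by
    rw [Subgroup.commutator_le]
    intro w hw y _
    have hw' : π₁ w.1 = 1 ∧ π₂ w.2 = 1 := by
      simpa [Φ, MonoidHom.mem_ker, Prod.ext_iff] using hw
    refine ⟨1, one_mem _, ?_, ?_⟩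
    · exact ((QuotientGroup.eq_one_iff ⁅w.1, y.1⁆).2
        (Subgroup.commutator_mem_commutator hw'.1 (Subgroup.mem_top _))).trans (by simp)
    · exact ((QuotientGroup.eq_one_iff ⁅w.2, y.2⁆).2
        (Subgroup.commutator_mem_commutator hw'.2 (Subgroup.mem_top _))).trans (by simp)
  have hJ : J.Normal := Subgroup.normal_of_commutator_le hleJ hJle
  let g := QuotientGroup.mk' J
  let p := QuotientGroup.lift J Φ hJle
  have hC : p.ker ≤ Subgroup.center ((Q₁ × Q₂) ⧸ J) := by
    intro c hc
    rw [Subgroup.mem_center_iff]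
    intro y
    obtain ⟨c, rfl⟩ := QuotientGroup.mk'_surjective J c
    obtain ⟨y, rfl⟩ := QuotientGroup.mk'_surjective J y
    have hc' : c⁻¹ ∈ Φ.ker := inv_mem hc
    rw [← map_mul, ← map_mul]
    refine QuotientGroup.eq.2 (hleJ ?_)
    have h := Subgroup.commutator_mem_commutator hc' (Subgroup.mem_top y⁻¹)
    simpa [commutatorElement_def, mul_assoc] using h
  have hglue : ∀ r ∈ π₀.ker, g (ψ₁ r, 1) = g (1, ψ₂ r) := fun r hr =>
    QuotientGroup.eq.2 ⟨r⁻¹, inv_mem hr, by simp, by simp⟩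
  -- By injectivity of `i₁` and `i₂`, `ψₖ(x)` lands in the central kernel only if `x` is a relation
  -- of `H`, and there the two maps already agree by `hglue`.
  have hker : ∀ {x}, (π₁ (ψ₁ x) = 1 ∨ π₂ (ψ₂ x) = 1) → x ∈ π₀.ker := by
    rintro x (hx | hx)
    · rw [← MonoidHom.comp_apply, hψ₁] at hx
      exact hG.injective_left (hx.trans (map_one i₁).symm)
    · rw [← MonoidHom.comp_apply, hψ₂] at hx
      exact hG.injective_right (hx.trans (map_one i₂).symm)
  have hp₁ : ∀ {r}, r ∈ π₁.ker → g (r, 1) ∈ p.ker := fun {r} hr =>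
    show Φ (r, 1) = 1 from Prod.ext hr (map_one π₂)
  have hp₂ : ∀ {r}, r ∈ π₂.ker → g (1, r) ∈ p.ker := fun {r} hr =>
    show Φ (1, r) = 1 from Prod.ext (map_one π₁) hr
  obtain ⟨E, hE, b₁, b₂, hb, hab, hbC, hB⟩ := hG.exists_lift_eq_one hπ₀ hπ₁ hπ₂ hψ₁ hψ₂ hC
    (g.comp (MonoidHom.inl Q₁ Q₂)) (g.comp (MonoidHom.inr Q₁ Q₂))
    ((g.comp (MonoidHom.inl Q₁ Q₂)).comp ψ₁) ((g.comp (MonoidHom.inr Q₁ Q₂)).comp ψ₂)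
    (fun r hr => hp₁ hr) (fun r hr => hp₂ hr)
    (fun x => by simp) (fun x => by simp)
    (fun x hx => hglue x (hker (Or.inl (congrArg Prod.fst (MonoidHom.mem_ker.1 hx)))))
    (fun x hx => hglue x (hker (Or.inr (congrArg Prod.snd (MonoidHom.mem_ker.1 hx)))))
  have h1 := hB _ hw
  have hC₂ : g (1, w₂) ∈ p.ker := hp₂ hw₂
  simp only [map_mul, map_inv, Coprod.lift_apply_inl, Coprod.lift_apply_inr,
    MonoidHom.comp_apply, MonoidHom.inl_apply, MonoidHom.inr_apply, ← hbC _ hC₂] at h1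
  rw [mul_inv_eq_one] at h1
  obtain ⟨r, hr, h2, h3⟩ := QuotientGroup.eq.1 (hb h1).symm
  refine ⟨r, hr, ?_, ?_⟩
  · simpa using h2
  · simpa using h3

end Detection

/-! ### The Mayer–Vietoris sequence -/

section MayerVietoris

open Monoid
open scoped commutatorElement

variable {H G₁ G₂ G K : Type*} [Group H] [Group G₁] [Group G₂] [Group G] [Group K]

namespace FreePresentation

theorem mk_eq_mk_iff (P : FreePresentation G) (x y : P.N) :
    (QuotientGroup.mk x : P.M) = QuotientGroup.mk y ↔
      QuotientGroup.mk' ⁅P.π.ker, (⊤ : Subgroup P.F)⁆ (x : P.F) = QuotientGroup.mk' _ (y : P.F) := by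
  rw [QuotientGroup.eq, Subgroup.mem_subgroupOf]
  exact QuotientGroup.eq.symm

theorem map_mk {P : FreePresentation G} {Q : FreePresentation K} {f : G →* K}
    {φ : P.F →* Q.F} (h : IsLift P Q f φ) (x : P.N) :
    P.map Q f (QuotientGroup.mk x) = QuotientGroup.mk ⟨φ x, h.map_N x⟩ := by
  rw [map_eq_mapOfLift φ h]
  rfl

end FreePresentation

theorem eq_of_mk'_eq {Y : Type*} [Group Y] (p : Y →* G) {x y : Y}
    (h : QuotientGroup.mk' ⁅p.ker, (⊤ : Subgroup Y)⁆ x = QuotientGroup.mk' _ y) : p x = p y := by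
  have h1 := Subgroup.commutator_le_left _ _ (QuotientGroup.eq.1 h)
  rw [MonoidHom.mem_ker, map_mul, map_inv, inv_mul_eq_one] at h1
  exact h1

theorem mem_commutator_of_mk'_eq {Y : Type*} [Group Y] (N : Subgroup Y) [N.Normal] {x y : Y}
    (h : QuotientGroup.mk' ⁅N, (⊤ : Subgroup Y)⁆ x = QuotientGroup.mk' _ y)
    (hx : x ∈ commutator Y) : y ∈ commutator Y := by
  have h1 : x⁻¹ * y ∈ commutator Y :=
    Subgroup.commutator_mono le_top le_rfl (QuotientGroup.eq.1 h)
  exact (Subgroup.mul_mem_cancel_left _ (inv_mem hx)).1 h1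

variable {i₁ : H →* G₁} {i₂ : H →* G₂} {j₁ : G₁ →* G} {j₂ : G₂ →* G}

namespace IsAmalgamatedProduct

theorem relator_mem_ker (hG : IsAmalgamatedProduct i₁ i₂ j₁ j₂) (h : H) :
    amalgamRelator i₁ i₂ h ∈ (Coprod.lift j₁ j₂).ker := by
  rw [hG.ker_eq]
  exact Subgroup.subset_normalClosure ⟨h, rfl⟩

/-- The homomorphism `H_ab → (G₁ ∗ G₂) / [L, G₁ ∗ G₂]`, `h ↦ i₁(h) i₂(h)⁻¹`. -/
noncomputable def relatorHom (hG : IsAmalgamatedProduct i₁ i₂ j₁ j₂) :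
    H →* Coprod G₁ G₂ ⧸ ⁅(Coprod.lift j₁ j₂).ker, (⊤ : Subgroup (Coprod G₁ G₂))⁆ where
  toFun h := QuotientGroup.mk' _ (amalgamRelator i₁ i₂ h)
  map_one' := by simp [amalgamRelator]
  map_mul' h h' := by
    have h1 := Subgroup.mem_center_iff.1
      (Subgroup.mk'_mem_center_of_mem _ (hG.relator_mem_ker h'))
      (QuotientGroup.mk' _ (Coprod.inr (i₂ h))⁻¹)
    -- The relator of `h'` sits between `i₁(h)` and `i₂(h)⁻¹`; being central in the quotient, it can
    -- be moved out.
    have e : amalgamRelator i₁ i₂ (h * h') = Coprod.inl (i₁ h) *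
        (amalgamRelator i₁ i₂ h' * (Coprod.inr (i₂ h))⁻¹) := by
      simp [amalgamRelator, mul_assoc]
    rw [e, map_mul, map_mul, ← h1, ← map_mul, ← map_mul, ← map_mul, ← mul_assoc]
    rfl

theorem relatorHom_mem_center (hG : IsAmalgamatedProduct i₁ i₂ j₁ j₂) (h : H) :
    hG.relatorHom h ∈ Subgroup.center
      (Coprod G₁ G₂ ⧸ ⁅(Coprod.lift j₁ j₂).ker, (⊤ : Subgroup (Coprod G₁ G₂))⁆) :=
  Subgroup.mk'_mem_center_of_mem _ (hG.relator_mem_ker h)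

/-- The image is central, hence abelian, so `H'` dies; that nothing more dies is the detection in
`G₁ × G₂ × H_ab`. -/
theorem ker_relatorHom (hG : IsAmalgamatedProduct i₁ i₂ j₁ j₂) :
    hG.relatorHom.ker = commutator H := by
  refine le_antisymm (fun h hh => mem_commutator_of_of_eq_one
    (hG.of_eq_one_of_relator_mem ((QuotientGroup.eq_one_iff _).1 hh))) ?_
  rw [commutator_def, Subgroup.commutator_le]
  intro h _ h' _
  rw [MonoidHom.mem_ker, map_commutatorElement, commutatorElement_eq_one_iff_commute]
  exact Subgroup.mem_center_iff.1 (hG.relatorHom_mem_center h') _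

/-- The range is central, hence normal, and contains the classes of the normal generators of `L`. -/
theorem map_ker_le_range_relatorHom (hG : IsAmalgamatedProduct i₁ i₂ j₁ j₂) :
    (Coprod.lift j₁ j₂).ker.map (QuotientGroup.mk' _) ≤ hG.relatorHom.range := by
  have hn : hG.relatorHom.range.Normal := ⟨by
    rintro _ ⟨h, rfl⟩ g
    rw [Subgroup.mem_center_iff.1 (hG.relatorHom_mem_center h), mul_inv_cancel_right]
    exact ⟨h, rfl⟩⟩
  rw [Subgroup.map_le_iff_le_comap]
  conv_lhs => rw [hG.ker_eq]
  refine Subgroup.normalClosure_le_normal ?_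
  rintro _ ⟨h, rfl⟩
  exact ⟨h, rfl⟩

/-- The connecting homomorphism exists. -/
theorem exists_connectingHom (hG : IsAmalgamatedProduct i₁ i₂ j₁ j₂) (P : FreePresentation G) :
    ∃ δ : P.M →* Abelianization H, IsConnectingHom i₁ i₂ j₁ j₂ P δ := by
  obtain ⟨σ₀, hσ₀⟩ := FreeGroup.exists_comp_eq hG.surjective P.π
  set q := QuotientGroup.mk' ⁅(Coprod.lift j₁ j₂).ker, (⊤ : Subgroup (Coprod G₁ G₂))⁆ with hq
  have hσN : ∀ x : P.N, σ₀ x ∈ (Coprod.lift j₁ j₂).ker := fun x => by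
    rw [MonoidHom.mem_ker, ← MonoidHom.comp_apply, hσ₀]
    exact x.2.1
  let s : P.N →* hG.relatorHom.range := ((q.comp σ₀).comp P.N.subtype).codRestrict _
    fun x => hG.map_ker_le_range_relatorHom ⟨_, hσN x, rfl⟩
  let s' : P.M →* hG.relatorHom.range := QuotientGroup.lift P.D s fun x hx =>
    Subtype.ext ((QuotientGroup.eq_one_iff _).2
      (map_mem_commutator_ker (f := MonoidHom.id G) hσ₀ hx))
  let e : Abelianization H ≃* hG.relatorHom.range :=
    (QuotientGroup.quotientMulEquivOfEq hG.ker_relatorHom.symm).trans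
      (QuotientGroup.quotientKerEquivRange hG.relatorHom)
  refine ⟨e.symm.toMonoidHom.comp s', fun σ hσ x h => ?_⟩
  have h1 : (e.symm.toMonoidHom.comp s') (QuotientGroup.mk x) = Abelianization.of h ↔
      s x = e (Abelianization.of h) := e.symm_apply_eq
  -- Independence of the choice of `σ`: this is where `x ∈ F'` is needed.
  have h2 : (s x : _) = q (σ x) := mk'_eq_of_mem_commutator _ (hσ₀.trans hσ.symm) x.2.2
  have h3 : (e (Abelianization.of h) : _) = q (amalgamRelator i₁ i₂ h) := rfl
  rw [h1, Subtype.ext_iff, h2, h3, eq_comm]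
  exact QuotientGroup.eq

end IsAmalgamatedProduct

theorem IsConnectingHom.apply_mk_eq_iff {P : FreePresentation G} {δ : P.M →* Abelianization H}
    (hδ : IsConnectingHom i₁ i₂ j₁ j₂ P δ) {σ : P.F →* Coprod G₁ G₂}
    (hσ : (Coprod.lift j₁ j₂).comp σ = P.π) (x : P.N) (h : H) :
    δ (QuotientGroup.mk x) = Abelianization.of h ↔
      QuotientGroup.mk' ⁅(Coprod.lift j₁ j₂).ker, (⊤ : Subgroup (Coprod G₁ G₂))⁆ (σ x) =
        QuotientGroup.mk' _ (amalgamRelator i₁ i₂ h) := by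
  rw [hδ σ hσ x h]
  exact QuotientGroup.eq.symm.trans eq_comm

theorem IsConnectingHom.apply_mk_eq_one_iff {P : FreePresentation G}
    {δ : P.M →* Abelianization H}
    (hδ : IsConnectingHom i₁ i₂ j₁ j₂ P δ) {σ : P.F →* Coprod G₁ G₂}
    (hσ : (Coprod.lift j₁ j₂).comp σ = P.π) (x : P.N) :
    δ (QuotientGroup.mk x) = 1 ↔
      σ x ∈ ⁅(Coprod.lift j₁ j₂).ker, (⊤ : Subgroup (Coprod G₁ G₂))⁆ := by
  have h := hδ σ hσ x 1
  simpa [amalgamRelator] using h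

/-- Exactness at `H_ab`. -/
theorem IsConnectingHom.range_eq (hG : IsAmalgamatedProduct i₁ i₂ j₁ j₂)
    {P : FreePresentation G} {δ : P.M →* Abelianization H}
    (hδ : IsConnectingHom i₁ i₂ j₁ j₂ P δ) :
    δ.range = ((Abelianization.map i₁).prod (Abelianization.map i₂)).ker := by
  obtain ⟨σ, hσ⟩ := FreeGroup.exists_comp_eq hG.surjective P.π
  ext a
  induction a using QuotientGroup.induction_on with | H h => ?_
  change Abelianization.of h ∈ _ ↔ Abelianization.of h ∈ _
  have hker : Abelianization.of h ∈
      ((Abelianization.map i₁).prod (Abelianization.map i₂)).ker ↔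
      i₁ h ∈ commutator G₁ ∧ i₂ h ∈ commutator G₂ := by
    rw [← Abelianization.ker_of G₁, ← Abelianization.ker_of G₂]
    exact Prod.ext_iff
  rw [hker]
  constructor
  · rintro ⟨m, hm⟩
    induction m using QuotientGroup.induction_on with | H x => ?_
    have h1 := mem_commutator_of_mk'_eq _ ((hδ.apply_mk_eq_iff hσ x h).1 hm)
      (map_mem_commutator σ x.2.2)
    -- Each projection of `G₁ ∗ G₂` onto a factor keeps one half of the relator.
    have h2 := map_mem_commutator Coprod.fst h1
    have h3 := map_mem_commutator Coprod.snd h1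
    simp only [amalgamRelator, map_mul, map_inv, Coprod.fst_apply_inl, Coprod.fst_apply_inr,
      Coprod.snd_apply_inl, Coprod.snd_apply_inr, inv_one, mul_one, one_mul, inv_mem_iff] at h2 h3
    exact ⟨h2, h3⟩
  · rintro ⟨h1, h2⟩
    have h3 : amalgamRelator i₁ i₂ h ∈ commutator (Coprod G₁ G₂) :=
      mul_mem (map_mem_commutator (Coprod.inl : G₁ →* Coprod G₁ G₂) h1)
        (inv_mem (map_mem_commutator (Coprod.inr : G₂ →* Coprod G₁ G₂) h2))
    obtain ⟨x, hx, hxe⟩ := exists_mem_commutator_mk'_eq P.surjective _ hσ h3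
    have hxR : x ∈ P.R := by
      rw [MonoidHom.mem_ker, ← hσ, MonoidHom.comp_apply, eq_of_mk'_eq _ hxe]
      exact hG.relator_mem_ker h
    exact ⟨QuotientGroup.mk ⟨x, hxR, hx⟩, (hδ.apply_mk_eq_iff hσ _ h).2 hxe⟩

/-- Exactness at `(G₁)_ab × (G₂)_ab`. -/
theorem IsAmalgamatedProduct.range_abelianization_eq
    (hG : IsAmalgamatedProduct i₁ i₂ j₁ j₂) :
    ((Abelianization.map i₁).prod (Abelianization.map i₂)).range =
      ((Abelianization.map j₁).comp
          (MonoidHom.fst (Abelianization G₁) (Abelianization G₂)) /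
        (Abelianization.map j₂).comp
          (MonoidHom.snd (Abelianization G₁) (Abelianization G₂))).ker := by
  refine le_antisymm ?_ ?_
  · rintro _ ⟨a, rfl⟩
    induction a using QuotientGroup.induction_on with | H h => ?_
    have h1 := DFunLike.congr_fun hG.comp_eq h
    simp only [MonoidHom.comp_apply] at h1
    rw [MonoidHom.mem_ker]
    change Abelianization.of (j₁ (i₁ h)) / Abelianization.of (j₂ (i₂ h)) = 1
    rw [h1, div_self']
  · rintro ⟨a, b⟩ hab
    induction a using QuotientGroup.induction_on with | H x => ?_
    induction b using QuotientGroup.induction_on with | H y => ?_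
    have h1 : Abelianization.of (j₁ x) / Abelianization.of (j₂ y) = 1 := hab
    rw [← map_div] at h1
    have h2 := mem_commutator_of_of_eq_one h1
    have h3 : commutator G = (commutator (Coprod G₁ G₂)).map (Coprod.lift j₁ j₂) := by
      rw [commutator_def, commutator_def, Subgroup.map_commutator,
        Subgroup.map_top_of_surjective _ hG.surjective]
    rw [h3] at h2
    obtain ⟨c, hc, hce⟩ := h2
    -- The inverse on the second factor makes `θ` send the relator of `h` to `([i₁(h)], [i₂(h)])`
    -- and `x y⁻¹` to `([x], [y])`. The commutator `c` corrects `x y⁻¹` to an element of `L` without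
    -- changing its image.
    let θ : Coprod G₁ G₂ →* Abelianization G₁ × Abelianization G₂ :=
      Coprod.lift ((MonoidHom.inl _ _).comp Abelianization.of)
        ((MonoidHom.inr _ _).comp Abelianization.of)⁻¹
    have hL : (Coprod.lift j₁ j₂).ker ≤
        ((Abelianization.map i₁).prod (Abelianization.map i₂)).range.comap θ := by
      rw [hG.ker_eq]
      refine Subgroup.normalClosure_le_normal ?_
      rintro _ ⟨h, rfl⟩
      exact ⟨Abelianization.of h, by simp [θ, amalgamRelator]⟩
    have h4 : Coprod.inl x * (Coprod.inr y)⁻¹ * c⁻¹ ∈ (Coprod.lift j₁ j₂).ker := by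
      rw [MonoidHom.mem_ker, map_mul, map_inv, hce]
      simp [div_eq_mul_inv]
    have h5 : θ c = 1 := Abelianization.commutator_subset_ker θ hc
    have h6 := hL h4
    rw [Subgroup.mem_comap, map_mul, map_inv, h5] at h6
    have h7 : θ (Coprod.inl x * (Coprod.inr y)⁻¹) = (Abelianization.of x, Abelianization.of y) := by
      simp [θ]
    rwa [inv_one, mul_one, h7] at h6

/-- Exactness at `G_ab`. -/
theorem IsAmalgamatedProduct.surjective_abelianization
    (hG : IsAmalgamatedProduct i₁ i₂ j₁ j₂) :
    Function.Surjective
      ((Abelianization.map j₁).comp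
          (MonoidHom.fst (Abelianization G₁) (Abelianization G₂)) /
        (Abelianization.map j₂).comp
          (MonoidHom.snd (Abelianization G₁) (Abelianization G₂))) := by
  intro a
  induction a using QuotientGroup.induction_on with | H g => ?_
  obtain ⟨z, rfl⟩ := hG.surjective g
  change _ ∈ Set.range _
  rw [← MonoidHom.coe_range]
  change Abelianization.of _ ∈ _
  induction z using Coprod.induction_on with
  | inl x => exact ⟨(Abelianization.of x, 1), by simp⟩
  | inr y => exact ⟨(1, (Abelianization.of y)⁻¹), by simp⟩
  | mul x y hx hy => rw [map_mul, map_mul]; exact mul_mem hx hy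

/-! ### Exactness at the Schur multipliers -/

theorem coprod_map_surjective {F₁ F₂ : Type*} [Group F₁] [Group F₂] {π₁ : F₁ →* G₁}
    {π₂ : F₂ →* G₂} (hπ₁ : Function.Surjective π₁) (hπ₂ : Function.Surjective π₂) :
    Function.Surjective (Coprod.map π₁ π₂) := by
  intro z
  change z ∈ Set.range _
  rw [← MonoidHom.coe_range]
  induction z using Coprod.induction_on with
  | inl x =>
    obtain ⟨x, rfl⟩ := hπ₁ x
    exact ⟨Coprod.inl x, Coprod.map_apply_inl _ _ _⟩
  | inr x =>
    obtain ⟨x, rfl⟩ := hπ₂ x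
    exact ⟨Coprod.inr x, Coprod.map_apply_inr _ _ _⟩
  | mul x y hx hy => exact mul_mem hx hy

/-- The product `R₁ R₂ [S, F₁ ∗ F₂]`, with `Rₖ = ker πₖ`, lies between `[S, F₁ ∗ F₂]` and `S`, so it
is already normal; containing `R₁` and `R₂`, it contains the kernel. -/
theorem exists_inl_mul_inr_mul_eq {F₁ F₂ : Type*} [Group F₁] [Group F₂] {π₁ : F₁ →* G₁}
    {π₂ : F₂ →* G₂} (hπ₁ : Function.Surjective π₁) (hπ₂ : Function.Surjective π₂)
    (S : Subgroup (Coprod F₁ F₂)) [S.Normal]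
    (hR₁ : π₁.ker.map Coprod.inl ≤ S) (hR₂ : π₂.ker.map Coprod.inr ≤ S)
    {z : Coprod F₁ F₂} (hz : z ∈ (Coprod.map π₁ π₂).ker) :
    ∃ r₁ ∈ π₁.ker, ∃ r₂ ∈ π₂.ker, ∃ t ∈ ⁅S, (⊤ : Subgroup (Coprod F₁ F₂))⁆,
      Coprod.inl r₁ * (Coprod.inr r₂ * t) = z := by
  have hle : ⁅S, (⊤ : Subgroup (Coprod F₁ F₂))⁆ ≤ S := Subgroup.commutator_le_left _ _
  have hT₂ : (π₂.ker.map Coprod.inr ⊔ ⁅S, (⊤ : Subgroup (Coprod F₁ F₂))⁆).Normal :=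
    Subgroup.normal_of_commutator_le le_sup_right (sup_le hR₂ hle)
  have hT : (π₁.ker.map Coprod.inl ⊔
      (π₂.ker.map Coprod.inr ⊔ ⁅S, (⊤ : Subgroup (Coprod F₁ F₂))⁆)).Normal :=
    Subgroup.normal_of_commutator_le (N := S)
      (le_sup_right.trans le_sup_right) (sup_le hR₁ (sup_le hR₂ hle))
  have hmem := ker_coprod_map_le hπ₁ hπ₂ (π₁.ker.map Coprod.inl ⊔
      (π₂.ker.map Coprod.inr ⊔ ⁅S, (⊤ : Subgroup (Coprod F₁ F₂))⁆))
    (fun r hr => Subgroup.mem_sup_left (Subgroup.mem_map_of_mem _ hr))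
    (fun r hr => Subgroup.mem_sup_right (Subgroup.mem_sup_left (Subgroup.mem_map_of_mem _ hr))) hz
  obtain ⟨_, ⟨r₁, hr₁, rfl⟩, t, ht, he⟩ := Subgroup.mem_sup_of_normal_right.1 hmem
  obtain ⟨_, ⟨r₂, hr₂, rfl⟩, t', ht', rfl⟩ := Subgroup.mem_sup_of_normal_right.1 ht
  exact ⟨r₁, hr₁, r₂, hr₂, t', ht', he⟩

/-- `F₁ ∗ F₂` maps the corresponding commutator subgroup onto `[L, G₁ ∗ G₂]`, so `y` may be
corrected to an element of the kernel of `F₁ ∗ F₂ → G₁ ∗ G₂`. -/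
theorem exists_mk'_eq_mk'_inl_mul_inr {F₁ F₂ : Type*} [Group F₁] [Group F₂] {π₁ : F₁ →* G₁}
    {π₂ : F₂ →* G₂} (hπ₁ : Function.Surjective π₁) (hπ₂ : Function.Surjective π₂)
    {y : Coprod F₁ F₂}
    (hy : Coprod.map π₁ π₂ y ∈
      ⁅(Coprod.lift j₁ j₂).ker, (⊤ : Subgroup (Coprod G₁ G₂))⁆) :
    ∃ r₁ ∈ π₁.ker, ∃ r₂ ∈ π₂.ker,
      QuotientGroup.mk' ⁅(Coprod.lift (j₁.comp π₁) (j₂.comp π₂)).ker,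
        (⊤ : Subgroup (Coprod F₁ F₂))⁆ y =
      QuotientGroup.mk' _ (Coprod.inl r₁ * Coprod.inr r₂) := by
  have hsurj := coprod_map_surjective hπ₁ hπ₂
  have hmap : ⁅(Coprod.lift j₁ j₂).ker, (⊤ : Subgroup (Coprod G₁ G₂))⁆ =
      ⁅(Coprod.lift (j₁.comp π₁) (j₂.comp π₂)).ker, (⊤ : Subgroup (Coprod F₁ F₂))⁆.map
        (Coprod.map π₁ π₂) := by
    rw [Subgroup.map_commutator, Subgroup.map_top_of_surjective _ hsurj,
      ← lift_comp_coprod_map, ← MonoidHom.comap_ker, Subgroup.map_comap_eq_self_of_surjective hsurj]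
  rw [hmap] at hy
  obtain ⟨s, hs, hsy⟩ := hy
  obtain ⟨r₁, hr₁, r₂, hr₂, t, ht, he⟩ := exists_inl_mul_inr_mul_eq hπ₁ hπ₂
    (Coprod.lift (j₁.comp π₁) (j₂.comp π₂)).ker
    (by
      rintro _ ⟨r, hr, rfl⟩
      rw [MonoidHom.mem_ker, Coprod.lift_apply_inl, MonoidHom.comp_apply,
        MonoidHom.mem_ker.1 hr, map_one])
    (by
      rintro _ ⟨r, hr, rfl⟩
      rw [MonoidHom.mem_ker, Coprod.lift_apply_inr, MonoidHom.comp_apply,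
        MonoidHom.mem_ker.1 hr, map_one])
    (z := y * s⁻¹) (by rw [MonoidHom.mem_ker, map_mul, map_inv, hsy, mul_inv_cancel])
  refine ⟨r₁, hr₁, r₂, hr₂, (QuotientGroup.eq.2 ?_).symm⟩
  rw [eq_mul_inv_iff_mul_eq] at he
  rw [← he, ← mul_assoc (Coprod.inl r₁), mul_assoc _ t, inv_mul_cancel_left]
  exact mul_mem ht hs

/-- Exactness at `M(G)`. -/
theorem IsConnectingHom.range_eq_ker (hG : IsAmalgamatedProduct i₁ i₂ j₁ j₂)
    (P₁ : FreePresentation G₁) (P₂ : FreePresentation G₂)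
    {P : FreePresentation G} {δ : P.M →* Abelianization H}
    (hδ : IsConnectingHom i₁ i₂ j₁ j₂ P δ) :
    ((P₁.map P j₁).comp (MonoidHom.fst P₁.M P₂.M) /
      (P₂.map P j₂).comp (MonoidHom.snd P₁.M P₂.M)).range = δ.ker := by
  have hφ₁ := FreePresentation.isLift_someLift P₁ P j₁
  have hφ₂ := FreePresentation.isLift_someLift P₂ P j₂
  set φ₁ := FreePresentation.someLift P₁ P j₁
  set φ₂ := FreePresentation.someLift P₂ P j₂
  refine le_antisymm ?_ ?_
  · obtain ⟨σ, hσ⟩ := FreeGroup.exists_comp_eq hG.surjective P.π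
    rintro _ ⟨⟨m₁, m₂⟩, rfl⟩
    induction m₁ using QuotientGroup.induction_on with | H x₁ => ?_
    induction m₂ using QuotientGroup.induction_on with | H x₂ => ?_
    change P₁.map P j₁ (QuotientGroup.mk x₁) / P₂.map P j₂ (QuotientGroup.mk x₂) ∈ δ.ker
    rw [FreePresentation.map_mk hφ₁, FreePresentation.map_mk hφ₂]
    refine div_mem ?_ ?_
    · refine (hδ.apply_mk_eq_one_iff hσ _).2 ((QuotientGroup.eq_one_iff _).1 ?_)
      refine (mk'_eq_of_mem_commutator _ (a := σ.comp φ₁) (b := Coprod.inl.comp P₁.π) ?_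
        x₁.2.2).trans ?_
      · rw [← MonoidHom.comp_assoc, hσ, hφ₁]
        ext; simp
      · have : P₁.π x₁ = 1 := x₁.2.1
        rw [MonoidHom.comp_apply, this, map_one, map_one]
    · refine (hδ.apply_mk_eq_one_iff hσ _).2 ((QuotientGroup.eq_one_iff _).1 ?_)
      refine (mk'_eq_of_mem_commutator _ (a := σ.comp φ₂) (b := Coprod.inr.comp P₂.π) ?_
        x₂.2.2).trans ?_
      · rw [← MonoidHom.comp_assoc, hσ, hφ₂]
        ext; simp
      · have : P₂.π x₂ = 1 := x₂.2.1
        rw [MonoidHom.comp_apply, this, map_one, map_one]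
  · intro m hm
    induction m using QuotientGroup.induction_on with | H x => ?_
    let p := Coprod.lift (j₁.comp P₁.π) (j₂.comp P₂.π)
    have hp : (Coprod.lift j₁ j₂).comp (Coprod.map P₁.π P₂.π) = p :=
      lift_comp_coprod_map _ _ _ _
    have hps : Function.Surjective p := by
      rw [← hp]
      exact hG.surjective.comp (coprod_map_surjective P₁.surjective P₂.surjective)
    -- Choosing `σ` to factor through `F₁ ∗ F₂` turns `δ = 1` into a decomposition `ρ(x) ≡ r₁ r₂`.
    -- As `ρ(x)` is a product of commutators, so is `r₁ r₂`, and the two projections put `rₖ` in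
    -- `Fₖ'`.
    obtain ⟨ρ, hρ⟩ := FreeGroup.exists_comp_eq hps P.π
    have hσ : (Coprod.lift j₁ j₂).comp ((Coprod.map P₁.π P₂.π).comp ρ) = P.π := by
      rw [← MonoidHom.comp_assoc, hp, hρ]
    obtain ⟨r₁, hr₁, r₂, hr₂, hr⟩ := exists_mk'_eq_mk'_inl_mul_inr (j₁ := j₁) (j₂ := j₂)
      P₁.surjective P₂.surjective ((hδ.apply_mk_eq_one_iff hσ x).1 hm)
    have hc := mem_commutator_of_mk'_eq _ hr (map_mem_commutator ρ x.2.2)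
    have hc₁ := map_mem_commutator Coprod.fst hc
    have hc₂ := map_mem_commutator Coprod.snd hc
    simp only [map_mul, Coprod.fst_apply_inl, Coprod.fst_apply_inr,
      Coprod.snd_apply_inl, Coprod.snd_apply_inr, mul_one, one_mul] at hc₁ hc₂
    let τ := Coprod.lift φ₁ φ₂
    have hτ : P.π.comp τ = p := Coprod.hom_ext
      (by rw [MonoidHom.comp_assoc, Coprod.lift_comp_inl, hφ₁, Coprod.lift_comp_inl])
      (by rw [MonoidHom.comp_assoc, Coprod.lift_comp_inr, hφ₂, Coprod.lift_comp_inr])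
    have h1 := mk'_map_eq_mk'_map (f := MonoidHom.id G) (p := P.π) (t := τ) hτ hr
    have h2 := mk'_eq_of_mem_commutator P.π (a := τ.comp ρ) (b := MonoidHom.id P.F)
      (by rw [← MonoidHom.comp_assoc, hτ, hρ, MonoidHom.comp_id]) x.2.2
    -- The inverse compensates for the sign in `j₁ - j₂`; mapping `ρ(x) ≡ r₁ r₂` back to `F` by `τ`
    -- gives `x`.
    refine ⟨(QuotientGroup.mk ⟨r₁, hr₁, hc₁⟩, (QuotientGroup.mk ⟨r₂, hr₂, hc₂⟩)⁻¹), ?_⟩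
    change P₁.map P j₁ (QuotientGroup.mk ⟨r₁, hr₁, hc₁⟩) /
      P₂.map P j₂ (QuotientGroup.mk ⟨r₂, hr₂, hc₂⟩)⁻¹ = _
    rw [map_inv, div_inv_eq_mul, FreePresentation.map_mk hφ₁, FreePresentation.map_mk hφ₂,
      ← QuotientGroup.mk_mul, FreePresentation.mk_eq_mk_iff]
    refine Eq.trans ?_ (h1.symm.trans h2)
    simp [τ]

/-- Exactness at `M(G₁) × M(G₂)`. -/
theorem IsAmalgamatedProduct.range_map_eq (hG : IsAmalgamatedProduct i₁ i₂ j₁ j₂)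
    (PH : FreePresentation H) (P₁ : FreePresentation G₁) (P₂ : FreePresentation G₂)
    (P : FreePresentation G) :
    ((PH.map P₁ i₁).prod (PH.map P₂ i₂)).range =
      ((P₁.map P j₁).comp (MonoidHom.fst P₁.M P₂.M) /
        (P₂.map P j₂).comp (MonoidHom.snd P₁.M P₂.M)).ker := by
  have hφ₁ := FreePresentation.isLift_someLift P₁ P j₁
  have hφ₂ := FreePresentation.isLift_someLift P₂ P j₂
  have hψ₁ := FreePresentation.isLift_someLift PH P₁ i₁
  have hψ₂ := FreePresentation.isLift_someLift PH P₂ i₂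
  set φ₁ := FreePresentation.someLift P₁ P j₁
  set φ₂ := FreePresentation.someLift P₂ P j₂
  set ψ₁ := FreePresentation.someLift PH P₁ i₁
  set ψ₂ := FreePresentation.someLift PH P₂ i₂
  refine le_antisymm ?_ ?_
  · rintro _ ⟨m, rfl⟩
    induction m using QuotientGroup.induction_on with | H x => ?_
    change P₁.map P j₁ (PH.map P₁ i₁ (QuotientGroup.mk x)) /
      P₂.map P j₂ (PH.map P₂ i₂ (QuotientGroup.mk x)) = 1
    rw [FreePresentation.map_mk hψ₁, FreePresentation.map_mk hψ₂, FreePresentation.map_mk hφ₁,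
      FreePresentation.map_mk hφ₂, div_eq_one, FreePresentation.mk_eq_mk_iff]
    refine mk'_eq_of_mem_commutator P.π (a := φ₁.comp ψ₁) (b := φ₂.comp ψ₂) ?_ x.2.2
    rw [← MonoidHom.comp_assoc, ← MonoidHom.comp_assoc, hφ₁, hφ₂, MonoidHom.comp_assoc,
      MonoidHom.comp_assoc, hψ₁, hψ₂, ← MonoidHom.comp_assoc, ← MonoidHom.comp_assoc,
      hG.comp_eq]
  · rintro ⟨m₁, m₂⟩ hm
    induction m₁ using QuotientGroup.induction_on with | H x₁ => ?_
    induction m₂ using QuotientGroup.induction_on with | H x₂ => ?_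
    replace hm : P₁.map P j₁ (QuotientGroup.mk x₁) / P₂.map P j₂ (QuotientGroup.mk x₂) = 1 := hm
    rw [FreePresentation.map_mk hφ₁, FreePresentation.map_mk hφ₂, div_eq_one,
      FreePresentation.mk_eq_mk_iff] at hm
    -- The presentation of `G₁` is enlarged so that the free group of `H` becomes a retract of its
    -- free group. Detection yields only a relation `r` of `H`; the retraction `Coprod.fst` then
    -- shows that `r` lies in the commutator subgroup.
    let π₁ : Coprod PH.F P₁.F →* G₁ := Coprod.lift (i₁.comp PH.π) P₁.π
    have hπ₁ : Function.Surjective π₁ := fun g => by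
      obtain ⟨x, rfl⟩ := P₁.surjective g
      exact ⟨Coprod.inr x, by simp [π₁]⟩
    let p := Coprod.lift (j₁.comp π₁) (j₂.comp P₂.π)
    have hps : Function.Surjective p := by
      change Function.Surjective (Coprod.lift (j₁.comp π₁) (j₂.comp P₂.π))
      rw [← lift_comp_coprod_map]
      exact hG.surjective.comp (coprod_map_surjective hπ₁ P₂.surjective)
    obtain ⟨ρ, hρ⟩ := FreeGroup.exists_comp_eq hps P.π
    have h1 := mk'_map_eq_mk'_map (f := MonoidHom.id G) (p := p) (t := ρ) hρ hm
    have h2 := mk'_eq_of_mem_commutator p (a := ρ.comp φ₁) (b := Coprod.inl.comp Coprod.inr)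
      (by
        rw [← MonoidHom.comp_assoc, hρ, hφ₁, ← MonoidHom.comp_assoc, Coprod.lift_comp_inl,
          MonoidHom.comp_assoc, Coprod.lift_comp_inr]) x₁.2.2
    have h3 := mk'_eq_of_mem_commutator p (a := ρ.comp φ₂) (b := Coprod.inr)
      (by rw [← MonoidHom.comp_assoc, hρ, hφ₂, Coprod.lift_comp_inr]) x₂.2.2
    have h4 := (h2.symm.trans h1).trans h3
    rw [← mul_inv_eq_one, ← map_inv, ← map_mul] at h4
    obtain ⟨r, hr, hr₁, hr₂⟩ := hG.exists_mem_ker_of_mul_inv_mem PH.surjective hπ₁ P₂.surjective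
      (ψ₁ := Coprod.inl) (Coprod.lift_comp_inl _ _) hψ₂ x₂.2.1
      ((QuotientGroup.eq_one_iff _).1 h4)
    have hrc : r ∈ commutator PH.F := by
      have h5 := map_mem_commutator Coprod.fst
        (mem_commutator_of_mk'_eq _ hr₁ (map_mem_commutator
          (Coprod.inr : P₁.F →* Coprod PH.F P₁.F) x₁.2.2))
      simpa using h5
    refine ⟨QuotientGroup.mk ⟨r, hr, hrc⟩, Prod.ext ?_ ?_⟩
    · change PH.map P₁ i₁ _ = _
      rw [FreePresentation.map_mk hψ₁, FreePresentation.mk_eq_mk_iff]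
      -- `θ` lies over `G₁` and carries the congruence from the enlarged presentation back to `P₁`.
      let θ : Coprod PH.F P₁.F →* P₁.F := Coprod.lift ψ₁ (MonoidHom.id _)
      have hθ : P₁.π.comp θ = π₁ := Coprod.hom_ext
        (by rw [MonoidHom.comp_assoc, Coprod.lift_comp_inl, hψ₁, Coprod.lift_comp_inl])
        (by rw [MonoidHom.comp_assoc, Coprod.lift_comp_inr, Coprod.lift_comp_inr,
          MonoidHom.comp_id])
      have h6 := mk'_map_eq_mk'_map (f := MonoidHom.id G₁) (p := P₁.π) (t := θ) hθ hr₁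
      simpa [θ] using h6.symm
    · change PH.map P₂ i₂ _ = _
      rw [FreePresentation.map_mk hψ₂, FreePresentation.mk_eq_mk_iff]
      exact hr₂.symm

end MayerVietoris

/-- The Mayer–Vietoris sequence
`M(H) → M(G₁) × M(G₂) → M(G) → H_ab → (G₁)_ab × (G₂)_ab → G_ab → 0`
of an amalgamated free product, for any free presentations of the four groups. -/
theorem theorem2p5 {H G₁ G₂ G : Type*} [Group H] [Group G₁] [Group G₂] [Group G]
    (i₁ : H →* G₁) (i₂ : H →* G₂) (j₁ : G₁ →* G) (j₂ : G₂ →* G)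
    (hG : IsAmalgamatedProduct i₁ i₂ j₁ j₂)
    (PH : FreePresentation H) (P₁ : FreePresentation G₁) (P₂ : FreePresentation G₂)
    (P : FreePresentation G) :
    ∃ δ : P.M →* Abelianization H,
      IsConnectingHom i₁ i₂ j₁ j₂ P δ ∧
      -- exactness at `M(G₁) × M(G₂)`
      ((PH.map P₁ i₁).prod (PH.map P₂ i₂)).range =
        ((P₁.map P j₁).comp (MonoidHom.fst P₁.M P₂.M) /
          (P₂.map P j₂).comp (MonoidHom.snd P₁.M P₂.M)).ker ∧
      -- exactness at `M(G)`
      ((P₁.map P j₁).comp (MonoidHom.fst P₁.M P₂.M) /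
          (P₂.map P j₂).comp (MonoidHom.snd P₁.M P₂.M)).range = δ.ker ∧
      -- exactness at `H_ab`
      δ.range = ((Abelianization.map i₁).prod (Abelianization.map i₂)).ker ∧
      -- exactness at `(G₁)_ab × (G₂)_ab`
      ((Abelianization.map i₁).prod (Abelianization.map i₂)).range =
        ((Abelianization.map j₁).comp
            (MonoidHom.fst (Abelianization G₁) (Abelianization G₂)) /
          (Abelianization.map j₂).comp
            (MonoidHom.snd (Abelianization G₁) (Abelianization G₂))).ker ∧
      -- exactness at `G_ab`
      Function.Surjective
        ((Abelianization.map j₁).comp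
            (MonoidHom.fst (Abelianization G₁) (Abelianization G₂)) /
          (Abelianization.map j₂).comp
            (MonoidHom.snd (Abelianization G₁) (Abelianization G₂))) := by
  obtain ⟨δ, hδ⟩ := hG.exists_connectingHom P
  exact ⟨δ, hδ, hG.range_map_eq PH P₁ P₂ P, hδ.range_eq_ker hG P₁ P₂, hδ.range_eq hG,
    hG.range_abelianization_eq, hG.surjective_abelianization⟩
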